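/- **Setting.** Let $\mathcal X$ be a data universe, $\mathcal S$ a set of internal states and $\mathcal O$ a set of outputs (measurable spaces). An *online algorithm* $M$ consists of randomized maps (Markov kernels) $M_1:\mathcal X\to\mathcal S$, $M_i:\mathcal S\times\mathcal X\to\mathcal S$ for $i\ge 2$, and $M_{\mathcal O}:\mathcal S\to\mathcal O$. On a stream $\vec x=(x_1,\dots,x_n)$, $n\ge 1$, it computes the states $s_1=M_1(x_1)$, $s_i=M_i(s_{i-1},x_i)$ for $2\le i\le n$, and publishes the output $M(\vec x)=M_{\mathcal O}(s_n)$. Two streams of length $n$ are *neighbors* if they differ in at most one element. $M$ is *$(\varepsilon,\delta)$-pan-private* on streams of length $n$ if for all neighboring streams $\vec x,\vec x\,'$ of length $n$, every time $t\in\{1,\dots,n\}$ and every measurable $T\subseteq\mathcal S\times\mathcal O$, $$\Pr[(s_t(\vec x),M(\vec x))\in T]\le e^{\varepsilon}\Pr[(s_t(\vec x\,'),M(\vec x\,'))\in T]+\delta .$$ Let $\{P_v\}_{v\in\mathcal V}$ be a family of probability distributions on $\mathcal X$ indexed by a finite nonempty set $\mathcal V$, let $V$ be uniform on $\mathcal V$,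 and put $U=\mathbb E_{v\sim V}[P_v]$ and $P_V^n=\mathbb E_{v\sim V}[P_v^n]$, where $P_v^n$ and $U^n$ are $n$-fold product measures. Define $$\|\{P_v\}\|_{\infty\to2}=\sup_{f:\mathcal X\to[-1,1]\text{ measurable}}\Big(\mathbb E_{v\sim V}\big[(\mathbb E_{x\sim P_v}f(x)-\mathbb E_{x\sim U}f(x))^2\big]\Big)^{1/2}.$$ Write $M(\mu)$ for the law of the output of $M$ on a random stream with distribution $\mu$, and $d_{TV}$ for total variation distance, $d_{TV}(\mu,\nu)=\sup_A|\mu(A)-\nu(A)|$. The expression $\delta\log(|\mathcal V|/\delta)$ is read as $0$ when $\delta=0$. **Theorem.** There is a numerical constant $\kappa>0$ such that for all constants $\varepsilon_0>0$ and $c>0$ there is a constant $C>0$, depending only on $\varepsilon_0$ and $c$, with the following property. Let $\{P_v\}_{v\in\mathcal V}$ be as above, let $n\ge1$, $0\le\varepsilon\le\varepsilon_0$ and $0\le\delta\le1$, and let $M$ be an online algorithm that is $(\varepsilon,\delta)$-pan-private on streams of length $n$ and satisfies $d_{TV}(M(P_V^n),M(U^n))\ge c$. Then: 1. if $\delta\log(|\mathcal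 V|/\delta)\le\kappa\,\varepsilon^2\|\{P_v\}\|_{\infty\to2}^2$, then $\varepsilon\|\{P_v\}\|_{\infty\to2}>0$ and $$n\ge\frac{1}{C\,\varepsilon\,\|\{P_v\}\|_{\infty\to2}};$$ 2. in general, $\varepsilon\|\{P_v\}\|_{\infty\to2}+\sqrt{\delta\log(|\mathcal V|/\delta)}>0$ and $$n\ge\frac{1}{C\left(\varepsilon\,\|\{P_v\}\|_{\infty\to2}+\sqrt{\delta\log(|\mathcal V|/\delta)}\right)}.$$ -/

import Mathlib

open MeasureTheory ProbabilityTheory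
open scoped ENNReal

noncomputable section

namespace PanPrivacy

/-- Appending a last coordinate to a tuple is measurable. -/
theorem measurable_snoc {S : Type*} [MeasurableSpace S] (n : ℕ) :
    Measurable (fun q : (Fin n → S) × S => (Fin.snoc q.1 q.2 : Fin (n + 1) → S)) := by
  refine measurable_pi_iff.mpr fun i => ?_
  induction i using Fin.lastCases with
  | last => simpa using measurable_snd
  | cast j =>
    simp only [Fin.snoc_castSucc]
    exact (measurable_pi_apply j).comp measurable_fst

/-- Forgetting the last coordinate of a tuple is measurable. -/
theorem measurable_init {X : Type*} [MeasurableSpace X] (n : ℕ) :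
    Measurable (fun x : Fin (n + 1) → X => (Fin.init x : Fin n → X)) :=
  measurable_pi_iff.mpr fun i => measurable_pi_apply (Fin.castSucc i)

/-- A (randomized) online algorithm over the data universe `X`, with internal states in `S` and
outputs in `O`: `first` maps the first data point to the first internal state, `next i` maps the
`(i + 1)`-st internal state and the `(i + 2)`-nd data point to the `(i + 2)`-nd internal state, and
`out` maps the final internal state to the published output.
Randomized maps are Markov kernels. -/
structure OnlineAlgorithm (X S O : Type*) [MeasurableSpace X] [MeasurableSpace S]
    [MeasurableSpace O] where
  first : Kernel X S
  next : ℕ → Kernel (S × X) S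
  out : Kernel S O
  isMarkov_first : IsMarkovKernel first
  isMarkov_next : ∀ i, IsMarkovKernel (next i)
  isMarkov_out : IsMarkovKernel out

namespace OnlineAlgorithm

variable {X S O : Type*} [MeasurableSpace X] [MeasurableSpace S] [MeasurableSpace O]

/-- The joint law of the successive internal states `(s_1, …, s_{n+1})` on a stream of `n + 1`
data points. -/
def states (M : OnlineAlgorithm X S O) : (n : ℕ) → Kernel (Fin (n + 1) → X) (Fin (n + 1) → S)
  | 0 => (M.first.comap (fun x : Fin 1 → X => x 0) (measurable_pi_apply 0)).map
      (fun s => fun _ : Fin 1 => s)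
  | n + 1 =>
      (((M.states n).comap (fun x : Fin (n + 2) → X => (Fin.init x : Fin (n + 1) → X))
            (measurable_init (n + 1))) ⊗ₖ
          ((M.next n).comap
            (fun p : (Fin (n + 2) → X) × (Fin (n + 1) → S) =>
              (p.2 (Fin.last n), p.1 (Fin.last (n + 1))))
            (((measurable_pi_apply (Fin.last n)).comp measurable_snd).prodMk
              ((measurable_pi_apply (Fin.last (n + 1))).comp measurable_fst)))).map
        (fun q : (Fin (n + 1) → S) × S => (Fin.snoc q.1 q.2 : Fin (n + 2) → S))

/-- The joint law of all internal states and of the published output on a stream of `n + 1` data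
points: the output is computed by `out` from the last internal state. -/
def run (M : OnlineAlgorithm X S O) (n : ℕ) :
    Kernel (Fin (n + 1) → X) ((Fin (n + 1) → S) × O) :=
  (M.states n) ⊗ₖ
    (M.out.comap (fun p : (Fin (n + 1) → X) × (Fin (n + 1) → S) => p.2 (Fin.last n))
      ((measurable_pi_apply (Fin.last n)).comp measurable_snd))

/-- The joint law of the internal state at time `t` and of the published output: the view of an
attacker who intrudes at time `t`. -/
def view (M : OnlineAlgorithm X S O) (n : ℕ) (t : Fin (n + 1)) :
    Kernel (Fin (n + 1) → X) (S × O) :=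
  (M.run n).map (fun r : (Fin (n + 1) → S) × O => (r.1 t, r.2))

/-- The law of the published output on a stream of `n + 1` data points. -/
def output (M : OnlineAlgorithm X S O) (n : ℕ) : Kernel (Fin (n + 1) → X) O :=
  (M.run n).map (fun r : (Fin (n + 1) → S) × O => r.2)

/-- The law of the published output when the stream of `n + 1` data points is random with
distribution `μ`. -/
def outputLaw (M : OnlineAlgorithm X S O) (n : ℕ) (μ : Measure (Fin (n + 1) → X)) : Measure O :=
  μ.bind (M.output n)

/-- The law of the internal states is a genuine probability distribution on every stream. -/
theorem isMarkovKernel_states (M : OnlineAlgorithm X S O) (n : ℕ) :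
    IsMarkovKernel (M.states n) := by
  have := M.isMarkov_first
  have := M.isMarkov_next
  induction n with
  | zero =>
    unfold states
    exact Kernel.IsMarkovKernel.map _ (measurable_pi_iff.mpr fun _ => measurable_id)
  | succ n ih =>
    unfold states
    exact Kernel.IsMarkovKernel.map _ (measurable_snoc (n + 1))

end OnlineAlgorithm

/-- Two streams of the same length are neighbors if they differ in at most one element. -/
def Neighbors {X : Type*} {n : ℕ} (x x' : Fin n → X) : Prop :=
  ∃ i : Fin n, ∀ j : Fin n, j ≠ i → x j = x' j

/-- `(ε, δ)`-pan-privacy on streams of `n + 1` data points: for every time `t`, the pair consisting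
of the internal state at time `t` and of the published output is `(ε, δ)`-differentially private. -/
def IsPanPrivate {X S O : Type*} [MeasurableSpace X] [MeasurableSpace S] [MeasurableSpace O]
    (M : OnlineAlgorithm X S O) (n : ℕ) (ε δ : ℝ) : Prop :=
  ∀ x x' : Fin (n + 1) → X, Neighbors x x' → ∀ t : Fin (n + 1),
    ∀ T : Set (S × O), MeasurableSet T →
      M.view n t x T ≤ ENNReal.ofReal (Real.exp ε) * M.view n t x' T + ENNReal.ofReal δ

/-- The uniform mixture `E_{v ∼ V} Q_v` of a finite family of measures. -/
def mixture {V Y : Type*} [Fintype V] [MeasurableSpace Y] (Q : V → Measure Y) : Measure Y :=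
  (Fintype.card V : ℝ≥0∞)⁻¹ • ∑ v, Q v

/-- The total variation distance `sup_A |μ(A) - ν(A)|`. -/
def tvDist {Y : Type*} [MeasurableSpace Y] (μ ν : Measure Y) : ℝ :=
  ⨆ A : {A : Set Y // MeasurableSet A}, |μ.real A - ν.real A|

/-- The `(∞ → 2)`-norm of a finite family of probability distributions:
`sup_f (E_{v ∼ V} (E_{x ∼ P_v} f(x) - E_{x ∼ U} f(x))²)^{1/2}` over the measurable functions
`f : X → [-1, 1]`, where `U` is the uniform mixture. -/
def infTwoNorm {V X : Type*} [Fintype V] [MeasurableSpace X] (P : V → Measure X) : ℝ :=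
  ⨆ f : {f : X → ℝ // Measurable f ∧ ∀ x, f x ∈ Set.Icc (-1 : ℝ) 1},
    Real.sqrt ((Fintype.card V : ℝ)⁻¹ *
      ∑ v, ((∫ x, f.1 x ∂(P v)) - ∫ x, f.1 x ∂(mixture P)) ^ 2)

end PanPrivacy

end

/-!
# Lower bounds for pan-private algorithms

Let `U` be the uniform mixture of the distributions `P v`. The `i`-th hybrid stream of `v` takes its
first `i` data points from `U` and the later ones from `P v`, so that the hybrids lead from the
product of the `P v` to the product of the `U`. Two consecutive hybrids differ in one data point
only. The prefix before it has a law that does not depend on `v`, and for given `v` everything after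
it is post-processing of the internal state reached there. Hence their outputs are at most as far
apart as the laws `Q ∘ P v` and `Q ∘ U`, where `Q` sends a data point to the law of the next
internal state after a prefix drawn from `U` (`tvDist_hybrid_le`). Pan-privacy at that time makes `Q` an
`(ε, δ)`-local randomizer (`isLocalRandomizer_randomizer`).

For a local randomizer `Q`, the average over `v` of the distance between `Q ∘ P v` and `Q ∘ U` is at
most `(exp ε - 1) ‖P‖ + 4 δ` (`average_tvDist_le`). Indeed, if `δ = 0`, the density of `Q x` with
respect to `Q ∘ U` at a fixed state is, as a function of `x`, within `exp ε - 1` of `1`. Centred and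
rescaled, it is a test function for the `(∞ → 2)`-norm, and by the Cauchy-Schwarz inequality the
average over `v` of its change in mean is at most `(exp ε - 1) ‖P‖`; integrating over the states
gives the claim. For positive `δ` the density is clipped first, at a cost of `2 δ` for each law.

Summing over the data points bounds the distance between the outputs by
`(n + 1) ((exp ε - 1) ‖P‖ + 4 δ)` on streams of `n + 1` data points (`tvDist_outputLaw_le`). A
positive distance needs at least two indices `v`, and then `δ` is at most twice the square root of
`δ log (|V| / δ)`; this yields both lower bounds.
-/

open MeasureTheory ProbabilityTheory
open scoped ENNReal

namespace PanPrivacy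

/-! ### Total variation distance -/

section TotalVariation

variable {Y Z : Type*} [MeasurableSpace Y] [MeasurableSpace Z]

theorem tvDist_le {μ ν : Measure Y} {r : ℝ}
    (h : ∀ A, MeasurableSet A → |μ.real A - ν.real A| ≤ r) : tvDist μ ν ≤ r := by
  have : Nonempty {A : Set Y // MeasurableSet A} := ⟨⟨∅, MeasurableSet.empty⟩⟩
  exact ciSup_le fun A => h A.1 A.2

theorem abs_real_sub_le_tvDist (μ ν : Measure Y) [IsProbabilityMeasure μ] [IsProbabilityMeasure ν]
    {A : Set Y} (hA : MeasurableSet A) : |μ.real A - ν.real A| ≤ tvDist μ ν := by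
  refine le_ciSup (f := fun A : {A : Set Y // MeasurableSet A} => |μ.real A.1 - ν.real A.1|)
    ⟨1, ?_⟩ ⟨A, hA⟩
  rintro _ ⟨B, rfl⟩
  have h1 := measureReal_le_one (μ := μ) (s := B.1)
  have h2 := measureReal_le_one (μ := ν) (s := B.1)
  have h3 := measureReal_nonneg (μ := μ) (s := B.1)
  have h4 := measureReal_nonneg (μ := ν) (s := B.1)
  exact abs_le.mpr ⟨by linarith, by linarith⟩

theorem tvDist_self_nonpos (μ : Measure Y) : tvDist μ μ ≤ 0 :=
  tvDist_le fun A _ => by simp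

theorem integral_sub_le_of_hahn {μ ν : Measure Y} [IsProbabilityMeasure μ]
    [IsProbabilityMeasure ν] {A : Set Y} (hA : MeasurableSet A)
    (hpos : ν.restrict A ≤ μ.restrict A) (hneg : μ.restrict Aᶜ ≤ ν.restrict Aᶜ)
    {g : Y → ℝ} (hg : Measurable g) (h0 : ∀ y, 0 ≤ g y) (h1 : ∀ y, g y ≤ 1) :
    ∫ y, g y ∂μ - ∫ y, g y ∂ν ≤ μ.real A - ν.real A := by
  have hint : ∀ (ρ : Measure Y) [IsFiniteMeasure ρ], Integrable g ρ := fun ρ _ =>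
    .of_bound hg.aestronglyMeasurable 1 (.of_forall fun y => by
      rw [Real.norm_eq_abs, abs_of_nonneg (h0 y)]; exact h1 y)
  have e1 := integral_mono_measure hneg (.of_forall h0) (hint _)
  have e2 := integral_mono_measure (f := fun y => 1 - g y) hpos
    (.of_forall fun y => sub_nonneg.mpr (h1 y)) ((integrable_const 1).sub (hint _))
  rw [integral_sub (integrable_const 1) (hint _), integral_sub (integrable_const 1) (hint _)] at e2
  simp only [integral_const, smul_eq_mul, mul_one, measureReal_restrict_apply MeasurableSet.univ,
    Set.univ_inter] at e2
  rw [← integral_add_compl hA (hint μ), ← integral_add_compl hA (hint ν)]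
  linarith

/-- On a Hahn set of `μ - ν` the total variation distance is attained, even among the test
functions with values in `[0, 1]`. -/
theorem exists_measurableSet_forall_integral_sub_le (μ ν : Measure Y) [IsProbabilityMeasure μ]
    [IsProbabilityMeasure ν] :
    ∃ A, MeasurableSet A ∧ ∀ g : Y → ℝ, Measurable g → (∀ y, 0 ≤ g y) → (∀ y, g y ≤ 1) →
      |∫ y, g y ∂μ - ∫ y, g y ∂ν| ≤ μ.real A - ν.real A := by
  obtain ⟨A, hA, hpos, hneg⟩ := hahn_decomposition μ ν
  have hpos' : ν.restrict A ≤ μ.restrict A := Measure.le_iff.mpr fun t ht => by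
    rw [Measure.restrict_apply ht, Measure.restrict_apply ht]
    exact hpos _ (ht.inter hA) Set.inter_subset_right
  have hneg' : μ.restrict Aᶜ ≤ ν.restrict Aᶜ := Measure.le_iff.mpr fun t ht => by
    rw [Measure.restrict_apply ht, Measure.restrict_apply ht]
    exact hneg _ (ht.inter hA.compl) Set.inter_subset_right
  refine ⟨A, hA, fun g hg h0 h1 => abs_le.mpr ⟨?_, ?_⟩⟩
  · have h := integral_sub_le_of_hahn hA hpos' hneg' (g := fun y => 1 - g y)
      (measurable_const.sub hg) (fun y => sub_nonneg.mpr (h1 y)) (fun y => by linarith [h0 y])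
    have hint : ∀ (ρ : Measure Y) [IsFiniteMeasure ρ], Integrable g ρ := fun ρ _ =>
      .of_bound hg.aestronglyMeasurable 1 (.of_forall fun y => by
        rw [Real.norm_eq_abs, abs_of_nonneg (h0 y)]; exact h1 y)
    rw [integral_sub (integrable_const 1) (hint _),
      integral_sub (integrable_const 1) (hint _)] at h
    simp only [integral_const, probReal_univ, smul_eq_mul, mul_one] at h
    linarith
  · exact integral_sub_le_of_hahn hA hpos' hneg' hg h0 h1

theorem exists_measurableSet_tvDist_le (μ ν : Measure Y) [IsProbabilityMeasure μ]
    [IsProbabilityMeasure ν] : ∃ A, MeasurableSet A ∧ tvDist μ ν ≤ μ.real A - ν.real A := by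
  obtain ⟨A, hA, h⟩ := exists_measurableSet_forall_integral_sub_le μ ν
  refine ⟨A, hA, tvDist_le fun B hB => ?_⟩
  have := h (B.indicator 1) (measurable_one.indicator hB)
    (fun y => Set.indicator_nonneg (fun _ _ => zero_le_one) y)
    (fun y => Set.indicator_le_self' (fun _ _ => zero_le_one) y)
  simpa [integral_indicator_one hB] using this

theorem real_comp_eq_integral (μ : Measure Y) (K : Kernel Y Z) [IsMarkovKernel K] {B : Set Z}
    (hB : MeasurableSet B) : (K ∘ₘ μ).real B = ∫ y, (K y).real B ∂μ := by
  rw [measureReal_def, Measure.bind_apply hB K.aemeasurable]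
  exact (integral_toReal (K.measurable_coe hB).aemeasurable
    (.of_forall fun y => measure_lt_top _ _)).symm

/-- Post-processing does not increase the total variation distance. -/
theorem tvDist_comp_le (μ ν : Measure Y) [IsProbabilityMeasure μ] [IsProbabilityMeasure ν]
    (K : Kernel Y Z) [IsMarkovKernel K] : tvDist (K ∘ₘ μ) (K ∘ₘ ν) ≤ tvDist μ ν := by
  obtain ⟨A, hA, h⟩ := exists_measurableSet_forall_integral_sub_le μ ν
  refine tvDist_le fun B hB => ?_
  rw [real_comp_eq_integral μ K hB, real_comp_eq_integral ν K hB]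
  exact (h _ (K.measurable_coe hB).ennreal_toReal (fun y => measureReal_nonneg)
    (fun y => measureReal_le_one)).trans
      ((le_abs_self _).trans (abs_real_sub_le_tvDist μ ν hA))

theorem tvDist_prod_le (μ ν : Measure Y) [IsProbabilityMeasure μ] [IsProbabilityMeasure ν]
    (ρ : Measure Z) [IsProbabilityMeasure ρ] :
    tvDist (μ.prod ρ) (ν.prod ρ) ≤ tvDist μ ν := by
  rw [← Measure.compProd_const, ← Measure.compProd_const, Measure.compProd_eq_comp_prod,
    Measure.compProd_eq_comp_prod]
  exact tvDist_comp_le μ ν _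

end TotalVariation

/-! ### Uniform mixtures and the `(∞ → 2)`-norm -/

section Mixture

variable {V X Y : Type*} [Fintype V] [MeasurableSpace X] [MeasurableSpace Y]

instance isProbabilityMeasure_mixture [Nonempty V] (Q : V → Measure Y)
    [∀ v, IsProbabilityMeasure (Q v)] : IsProbabilityMeasure (mixture Q) := by
  constructor
  simp only [mixture, Measure.smul_apply, Measure.finsetSum_apply, measure_univ, smul_eq_mul,
    Finset.sum_const, Finset.card_univ, nsmul_eq_mul, mul_one]
  exact ENNReal.inv_mul_cancel (by simp) (by simp)

theorem mixture_real_apply (Q : V → Measure Y) [∀ v, IsProbabilityMeasure (Q v)] (A : Set Y) :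
    (mixture Q).real A = (Fintype.card V : ℝ)⁻¹ * ∑ v, (Q v).real A := by
  simp only [mixture, measureReal_def, Measure.smul_apply, Measure.finsetSum_apply, smul_eq_mul,
    ENNReal.toReal_mul, ENNReal.toReal_inv, ENNReal.toReal_natCast]
  rw [ENNReal.toReal_sum fun v _ => measure_ne_top _ _]

theorem mixture_bind (Q : V → Measure X) (K : Kernel X Y) :
    K ∘ₘ (mixture Q) = mixture fun v => K ∘ₘ Q v := by
  ext A hA
  rw [Measure.bind_apply hA K.aemeasurable]
  simp only [mixture, lintegral_smul_measure, lintegral_finsetSum_measure, Measure.smul_apply,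
    Measure.finsetSum_apply]
  simp only [Measure.bind_apply hA K.aemeasurable]

theorem mixture_of_subsingleton [Nonempty V] [Subsingleton V] (Q : V → Measure Y) (v : V) :
    mixture Q = Q v := by
  have := Fintype.card_eq_one_iff.mpr ⟨v, fun w => Subsingleton.elim w v⟩
  have hu : (Finset.univ : Finset V) = {v} := by ext w; simp [Subsingleton.elim w v]
  simp [mixture, this, hu]

theorem abs_integral_le_of_abs_le {g : X → ℝ} {r : ℝ} (h : ∀ x, |g x| ≤ r) (μ : Measure X)
    [IsProbabilityMeasure μ] : |∫ x, g x ∂μ| ≤ r := by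
  simpa using norm_integral_le_of_norm_le_const (μ := μ) (f := g) (C := r) (.of_forall h)

theorem average_le [Nonempty V] {a : V → ℝ} {r : ℝ} (h : ∀ v, a v ≤ r) :
    (Fintype.card V : ℝ)⁻¹ * ∑ v, a v ≤ r := by
  have hc : (0 : ℝ) < Fintype.card V := by exact_mod_cast Fintype.card_pos
  rw [inv_mul_le_iff₀ hc]
  simpa using Finset.sum_le_sum fun v (_ : v ∈ Finset.univ) => h v

theorem average_abs_le_sqrt_average_sq [Nonempty V] (a : V → ℝ) :
    (Fintype.card V : ℝ)⁻¹ * ∑ v, |a v| ≤ Real.sqrt ((Fintype.card V : ℝ)⁻¹ * ∑ v, a v ^ 2) := by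
  have hc : (0 : ℝ) < Fintype.card V := by exact_mod_cast Fintype.card_pos
  refine Real.le_sqrt_of_sq_le ?_
  have h := sq_sum_le_card_mul_sum_sq (s := Finset.univ) (f := fun v => |a v|)
  simp only [sq_abs, Finset.card_univ] at h
  rw [mul_pow]
  calc _ ≤ ((Fintype.card V : ℝ)⁻¹) ^ 2 * (Fintype.card V * ∑ v, a v ^ 2) := by gcongr
    _ = _ := by field_simp

theorem infTwoNorm_nonneg (P : V → Measure X) : 0 ≤ infTwoNorm P :=
  Real.iSup_nonneg fun _ => Real.sqrt_nonneg _

variable [Nonempty V] (P : V → Measure X) [∀ v, IsProbabilityMeasure (P v)]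

theorem sqrt_average_le_infTwoNorm {f : X → ℝ} (hf : Measurable f)
    (h1 : ∀ x, f x ∈ Set.Icc (-1 : ℝ) 1) :
    Real.sqrt ((Fintype.card V : ℝ)⁻¹ * ∑ v, ((∫ x, f x ∂P v) - ∫ x, f x ∂mixture P) ^ 2)
      ≤ infTwoNorm P := by
  refine le_ciSup (f := fun f : {f : X → ℝ // Measurable f ∧ ∀ x, f x ∈ Set.Icc (-1 : ℝ) 1} =>
    Real.sqrt ((Fintype.card V : ℝ)⁻¹ *
      ∑ v, ((∫ x, f.1 x ∂(P v)) - ∫ x, f.1 x ∂(mixture P)) ^ 2)) ⟨Real.sqrt 4, ?_⟩ ⟨f, hf, h1⟩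
  rintro _ ⟨⟨g, hg, hg1⟩, rfl⟩
  refine Real.sqrt_le_sqrt (average_le fun v => ?_)
  have e1 := abs_le.mp (abs_integral_le_of_abs_le (fun x => abs_le.mpr (hg1 x)) (P v))
  have e2 := abs_le.mp (abs_integral_le_of_abs_le (fun x => abs_le.mpr (hg1 x)) (mixture P))
  nlinarith

theorem average_abs_integral_sub_le {g : X → ℝ} (hg : Measurable g) {r : ℝ} (hr : 0 ≤ r)
    (h : ∀ x, |g x| ≤ r) :
    (Fintype.card V : ℝ)⁻¹ * ∑ v, |(∫ x, g x ∂P v) - ∫ x, g x ∂mixture P|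
      ≤ r * infTwoNorm P := by
  rcases hr.eq_or_lt with rfl | hr
  · have : ∀ x, g x = 0 := fun x => abs_nonpos_iff.mp (h x)
    simp [this]
  have h' := (average_abs_le_sqrt_average_sq _).trans
    (sqrt_average_le_infTwoNorm P (f := fun x => g x / r) (hg.div_const r)
    (fun x => abs_le.mp (by rw [abs_div, abs_of_pos hr, div_le_one hr]; exact h x)))
  simp only [integral_div, ← sub_div, abs_div, abs_of_pos hr, ← Finset.sum_div] at h'
  rw [← mul_div_assoc, div_le_iff₀ hr] at h'
  linarith

end Mixture

/-! ### Local randomizers -/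

section LocalRandomizer

variable {X S B V : Type*} [MeasurableSpace X] [MeasurableSpace S] [MeasurableSpace B]

/-- A randomized map `Q` is an `(ε, δ)`-local randomizer if its laws at any two inputs are
`(ε, δ)`-indistinguishable. -/
def IsLocalRandomizer (Q : Kernel X S) (ε δ : ℝ) : Prop :=
  ∀ x x' : X, ∀ T : Set S, MeasurableSet T →
    (Q x).real T ≤ Real.exp ε * (Q x').real T + δ

theorem IsLocalRandomizer.map {Q : Kernel X S} {ε δ : ℝ} (hQ : IsLocalRandomizer Q ε δ)
    {φ : S → B} (hφ : Measurable φ) : IsLocalRandomizer (Q.map φ) ε δ := by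
  intro x x' T hT
  rw [Kernel.map_apply _ hφ, Kernel.map_apply _ hφ, map_measureReal_apply hφ hT,
    map_measureReal_apply hφ hT]
  exact hQ x x' _ (hφ hT)

theorem integrable_kernel_real (Q : Kernel X S) [IsMarkovKernel Q] (μ : Measure X)
    [IsFiniteMeasure μ] {T : Set S} (hT : MeasurableSet T) :
    Integrable (fun x => (Q x).real T) μ :=
  .of_bound (Q.measurable_coe hT).ennreal_toReal.aestronglyMeasurable 1 (.of_forall fun x => by
    rw [Real.norm_eq_abs, abs_of_nonneg measureReal_nonneg]; exact measureReal_le_one)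

theorem IsLocalRandomizer.real_le_comp {Q : Kernel X S} [IsMarkovKernel Q] {ε δ : ℝ}
    (hQ : IsLocalRandomizer Q ε δ) (μ : Measure X) [IsProbabilityMeasure μ] (x : X) {T : Set S}
    (hT : MeasurableSet T) : (Q x).real T ≤ Real.exp ε * (Q ∘ₘ μ).real T + δ := by
  have hint := integrable_kernel_real Q μ hT
  have h := integral_mono (μ := μ) (integrable_const _)
    (g := fun x' => Real.exp ε * (Q x').real T + δ)
    ((hint.const_mul (Real.exp ε)).add (integrable_const δ)) fun x' => hQ x x' T hT
  simp only [integral_const, probReal_univ, one_smul] at h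
  rw [integral_add (hint.const_mul _) (integrable_const _), integral_const_mul] at h
  rw [real_comp_eq_integral μ Q hT]
  simpa using h

theorem IsLocalRandomizer.comp_le_real {Q : Kernel X S} [IsMarkovKernel Q] {ε δ : ℝ}
    (hQ : IsLocalRandomizer Q ε δ) (μ : Measure X) [IsProbabilityMeasure μ] (x : X) {T : Set S}
    (hT : MeasurableSet T) : (Q ∘ₘ μ).real T ≤ Real.exp ε * (Q x).real T + δ := by
  have h := integral_mono (μ := μ) (integrable_kernel_real Q μ hT)
    (integrable_const _) fun x' => hQ x' x T hT
  rw [real_comp_eq_integral μ Q hT]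
  simpa using h

/-- The weight `p` clipped to the interval `[exp (-ε) q, exp ε q]`. -/
noncomputable def clip (ε q p : ℝ) : ℝ := max (Real.exp (-ε) * q) (min (Real.exp ε * q) p)

theorem abs_clip_sub_le {ε q : ℝ} (hε : 0 ≤ ε) (hq : 0 ≤ q) (p : ℝ) :
    |clip ε q p - q| ≤ (Real.exp ε - 1) * q := by
  have h1 : 1 ≤ Real.exp ε := Real.one_le_exp hε
  have h2 : Real.exp (-ε) ≤ 1 := Real.exp_le_one_iff.mpr (by linarith)
  have h3 : 1 - Real.exp (-ε) ≤ Real.exp ε - 1 := by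
    have := Real.add_one_le_exp ε
    have := Real.add_one_le_exp (-ε)
    linarith
  have h4 := mul_le_mul_of_nonneg_right h3 hq
  have h5 := mul_le_mul_of_nonneg_right (h2.trans h1) hq
  refine abs_le.mpr ⟨?_, ?_⟩
  · have := le_max_left (Real.exp (-ε) * q) (min (Real.exp ε * q) p)
    unfold clip; linarith
  · have : clip ε q p ≤ Real.exp ε * q := max_le h5 (min_le_left _ _)
    linarith

theorem abs_sub_clip_le {ε q : ℝ} (hε : 0 ≤ ε) (hq : 0 ≤ q) (p : ℝ) :
    |p - clip ε q p| ≤ max (p - Real.exp ε * q) 0 + max (Real.exp (-ε) * q - p) 0 := by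
  have h5 : Real.exp (-ε) * q ≤ Real.exp ε * q :=
    mul_le_mul_of_nonneg_right (Real.exp_le_exp.mpr (by linarith)) hq
  unfold clip
  rcases max_cases (Real.exp (-ε) * q) (min (Real.exp ε * q) p) with h | h <;>
  rcases min_cases (Real.exp ε * q) p with h' | h' <;>
  rcases max_cases (p - Real.exp ε * q) 0 with h'' | h'' <;>
  rcases max_cases (Real.exp (-ε) * q - p) 0 with h''' | h''' <;>
  rw [abs_le] <;> constructor <;> linarith

theorem sum_max_zero_le {B : Type*} [Fintype B] {a : B → ℝ} {δ : ℝ}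
    (h : ∀ T : Finset B, ∑ b ∈ T, a b ≤ δ) :
    ∑ b, max (a b) 0 ≤ δ := by
  classical
  have := h (Finset.univ.filter fun b => 0 ≤ a b)
  rw [Finset.sum_filter] at this
  refine le_trans (le_of_eq (Finset.sum_congr rfl fun b _ => ?_)) this
  split_ifs with hb
  · exact max_eq_left hb
  · exact max_eq_right (not_le.mp hb).le

/-- Clipping one of two `(ε, δ)`-indistinguishable distributions on a finite set to the window where
the other one would put it if `δ` were `0` changes it by at most `2 δ`. -/
theorem sum_abs_sub_clip_le {B : Type*} [Fintype B] {p q : B → ℝ} (hq : ∀ b, 0 ≤ q b)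
    {ε δ : ℝ} (hε : 0 ≤ ε)
    (h1 : ∀ T : Finset B, ∑ b ∈ T, p b ≤ Real.exp ε * ∑ b ∈ T, q b + δ)
    (h2 : ∀ T : Finset B, ∑ b ∈ T, q b ≤ Real.exp ε * ∑ b ∈ T, p b + δ) :
    ∑ b, |p b - clip ε (q b) (p b)| ≤ 2 * δ := by
  have hδ : 0 ≤ δ := by simpa using h1 ∅
  have e1 : ∑ b, max (p b - Real.exp ε * q b) 0 ≤ δ := sum_max_zero_le fun T => by
    rw [Finset.sum_sub_distrib, ← Finset.mul_sum]; linarith [h1 T]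
  have e2 : ∑ b, max (Real.exp (-ε) * q b - p b) 0 ≤ δ := sum_max_zero_le fun T => by
    rw [Finset.sum_sub_distrib, ← Finset.mul_sum, Real.exp_neg, sub_le_iff_le_add,
      inv_mul_le_iff₀ (Real.exp_pos ε)]
    nlinarith [h2 T, mul_le_mul_of_nonneg_right (Real.one_le_exp hε) hδ]
  calc _ ≤ ∑ b, (max (p b - Real.exp ε * q b) 0 + max (Real.exp (-ε) * q b - p b) 0) :=
        Finset.sum_le_sum fun b _ => abs_sub_clip_le hε (hq b) _
    _ ≤ 2 * δ := by rw [Finset.sum_add_distrib]; linarith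

variable [Fintype V] [Nonempty V] (P : V → Measure X) [∀ v, IsProbabilityMeasure (P v)]

/-- The main estimate for a local randomizer with finitely many outcomes. Relative to the law `q`
of `Q` at the mixture, the law of `Q` at `x` has, up to an error of mass `2 δ`, a density within
`exp ε - 1` of `1`; as a function of `x`, this density is a test function for the `(∞ → 2)`-norm. -/
theorem average_sum_abs_sub_le [Fintype B] [MeasurableSingletonClass B] {Q : Kernel X B}
    [IsMarkovKernel Q] {ε δ : ℝ} (hε : 0 ≤ ε) (hQ : IsLocalRandomizer Q ε δ) :
    (Fintype.card V : ℝ)⁻¹ *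
        ∑ v, ∑ b, |(Q ∘ₘ P v).real {b} - (Q ∘ₘ mixture P).real {b}|
      ≤ (Real.exp ε - 1) * infTwoNorm P + 4 * δ := by
  set q : B → ℝ := fun b => (Q ∘ₘ mixture P).real {b} with hqdef
  have hq : ∀ b, 0 ≤ q b := fun b => measureReal_nonneg
  set r : B → X → ℝ := fun b x => clip ε (q b) ((Q x).real {b})
  have hQm : ∀ b, Measurable fun x => (Q x).real {b} := fun b =>
    (Q.measurable_coe (measurableSet_singleton b)).ennreal_toReal
  have hrm : ∀ b, Measurable (r b) := fun b =>
    measurable_const.max (measurable_const.min (hQm b))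
  have hrq : ∀ b x, |r b x - q b| ≤ (Real.exp ε - 1) * q b := fun b x =>
    abs_clip_sub_le hε (hq b) _
  have hsum : ∀ (μ : Measure B) [IsFiniteMeasure μ] (T : Finset B),
      ∑ b ∈ T, μ.real {b} = μ.real T :=
    fun μ _ T => sum_measureReal_singleton T
  have hclip : ∀ x, ∑ b, |(Q x).real {b} - r b x| ≤ 2 * δ := fun x =>
    sum_abs_sub_clip_le hq hε
      (fun T => by
        rw [hsum, hsum]; exact hQ.real_le_comp _ x T.measurableSet)
      (fun T => by
        rw [hsum, hsum]; exact hQ.comp_le_real _ x T.measurableSet)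
  have hrint : ∀ b (μ : Measure X) [IsFiniteMeasure μ], Integrable (r b) μ := fun b μ _ =>
    .of_bound (hrm b).aestronglyMeasurable ((Real.exp ε - 1) * q b + q b) (.of_forall fun x => by
      have := abs_sub_abs_le_abs_sub (r b x) (q b)
      rw [abs_of_nonneg (hq b)] at this
      rw [Real.norm_eq_abs]
      linarith [hrq b x])
  have hQint : ∀ b (μ : Measure X) [IsFiniteMeasure μ], Integrable (fun x => (Q x).real {b}) μ :=
    fun b μ _ => integrable_kernel_real Q μ (measurableSet_singleton b)
  have herr : ∀ (μ : Measure X) [IsProbabilityMeasure μ],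
      ∑ b, |(Q ∘ₘ μ).real {b} - ∫ x, r b x ∂μ| ≤ 2 * δ := by
    intro μ _
    calc _ ≤ ∑ b, ∫ x, |(Q x).real {b} - r b x| ∂μ := Finset.sum_le_sum fun b _ => by
          rw [real_comp_eq_integral μ Q (measurableSet_singleton b),
            ← integral_sub (hQint b μ) (hrint b μ)]
          exact abs_integral_le_integral_abs
      _ = ∫ x, ∑ b, |(Q x).real {b} - r b x| ∂μ :=
          (integral_finsetSum _ fun b _ => ((hQint b μ).sub (hrint b μ)).abs).symm
      _ ≤ ∫ _, 2 * δ ∂μ := integral_mono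
          (integrable_finsetSum _ fun b _ => ((hQint b μ).sub (hrint b μ)).abs)
          (integrable_const _) hclip
      _ = 2 * δ := by simp
  have hcenter : ∀ b v, (∫ x, (r b x - q b) ∂P v) - ∫ x, (r b x - q b) ∂mixture P
      = (∫ x, r b x ∂P v) - ∫ x, r b x ∂mixture P := fun b v => by
    rw [integral_sub (hrint b _) (integrable_const _),
      integral_sub (hrint b _) (integrable_const _)]
    simp
  have hmain : ∀ b, (Fintype.card V : ℝ)⁻¹ * ∑ v, |(∫ x, r b x ∂P v) - ∫ x, r b x ∂mixture P|
      ≤ (Real.exp ε - 1) * q b * infTwoNorm P := fun b => by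
    have := average_abs_integral_sub_le P ((hrm b).sub_const (q b))
      (mul_nonneg (sub_nonneg.mpr (Real.one_le_exp hε)) (hq b)) (hrq b)
    simpa only [hcenter] using this
  have hqsum : ∑ b, q b = 1 := by
    rw [hqdef, hsum]; simp
  have hv : ∀ v, ∑ b, |(Q ∘ₘ P v).real {b} - q b|
      ≤ ∑ b, |(∫ x, r b x ∂P v) - ∫ x, r b x ∂mixture P| + 4 * δ := fun v => by
    have : ∀ b, |(Q ∘ₘ P v).real {b} - q b| ≤ |(∫ x, r b x ∂P v) - ∫ x, r b x ∂mixture P|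
        + |(Q ∘ₘ P v).real {b} - ∫ x, r b x ∂P v| + |q b - ∫ x, r b x ∂mixture P| := fun b => by
      have e1 := abs_sub_le ((Q ∘ₘ P v).real {b}) (∫ x, r b x ∂P v) (q b)
      have e2 := abs_sub_le (∫ x, r b x ∂P v) (∫ x, r b x ∂mixture P) (q b)
      rw [abs_sub_comm (∫ x, r b x ∂mixture P) (q b)] at e2
      linarith
    have h := Finset.sum_le_sum fun b (_ : b ∈ Finset.univ) => this b
    rw [Finset.sum_add_distrib, Finset.sum_add_distrib] at h
    linarith [herr (P v), herr (mixture P)]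
  calc _ ≤ (Fintype.card V : ℝ)⁻¹ *
        ∑ v, (∑ b, |(∫ x, r b x ∂P v) - ∫ x, r b x ∂mixture P| + 4 * δ) := by
        gcongr with v; exact hv v
    _ = ∑ b, (Fintype.card V : ℝ)⁻¹ * ∑ v, |(∫ x, r b x ∂P v) - ∫ x, r b x ∂mixture P|
        + 4 * δ := by
        rw [Finset.sum_add_distrib, Finset.sum_comm, mul_add, Finset.mul_sum]
        simp
    _ ≤ ∑ b, (Real.exp ε - 1) * q b * infTwoNorm P + 4 * δ := by
        exact add_le_add (Finset.sum_le_sum fun b _ => hmain b) le_rfl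
    _ = _ := by rw [← Finset.sum_mul, ← Finset.mul_sum, hqsum, mul_one]

/-- A local randomizer reveals little about the index `v` of the distribution of its input.
The state space is arbitrary, so its laws need not have jointly measurable densities; the proof
passes to the finite partition generated by the sets on which the distances are attained. -/
theorem average_tvDist_le {Q : Kernel X S} [IsMarkovKernel Q] {ε δ : ℝ} (hε : 0 ≤ ε)
    (hQ : IsLocalRandomizer Q ε δ) :
    (Fintype.card V : ℝ)⁻¹ * ∑ v, tvDist (Q ∘ₘ P v) (Q ∘ₘ mixture P)
      ≤ (Real.exp ε - 1) * infTwoNorm P + 4 * δ := by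
  classical
  choose A hA hTV using fun v => exists_measurableSet_tvDist_le (Q ∘ₘ P v) (Q ∘ₘ mixture P)
  let φ : S → V → Bool := fun s v => decide (s ∈ A v)
  have hφ : Measurable φ := measurable_pi_iff.mpr fun v =>
    measurable_to_bool (by simpa [φ, Set.preimage] using hA v)
  have : IsMarkovKernel (Q.map φ) := Kernel.IsMarkovKernel.map _ hφ
  refine le_trans ?_ (average_sum_abs_sub_le P hε (hQ.map hφ))
  gcongr with v
  refine (hTV v).trans ?_
  have key : ∀ μ : Measure X, IsProbabilityMeasure μ → (Q ∘ₘ μ).real (A v)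
      = ∑ b ∈ Finset.univ.filter (fun b : V → Bool => b v = true), (Q.map φ ∘ₘ μ).real {b} := by
    intro μ _
    rw [sum_measureReal_singleton, ← Measure.map_comp _ _ hφ,
      map_measureReal_apply hφ (Finset.measurableSet _)]
    congr 1
    ext s
    simp [φ]
  rw [key _ inferInstance, key _ inferInstance, ← Finset.sum_sub_distrib]
  exact (Finset.sum_le_sum fun b _ => le_abs_self _).trans
    (Finset.sum_le_sum_of_subset_of_nonneg (Finset.filter_subset _ _) fun b _ _ => abs_nonneg _)

end LocalRandomizer

/-! ### Online algorithms on streams of independent data points -/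

namespace OnlineAlgorithm

variable {X S O : Type*} [MeasurableSpace X] [MeasurableSpace S] [MeasurableSpace O]
  (M : OnlineAlgorithm X S O)

/-- The law of the last internal state on a stream of `k + 1` data points. -/
noncomputable def lastState (k : ℕ) : Kernel (Fin (k + 1) → X) S :=
  (M.states k).map fun s => s (Fin.last k)

instance isMarkovKernel_lastState (k : ℕ) : IsMarkovKernel (M.lastState k) := by
  have := M.isMarkovKernel_states k
  exact Kernel.IsMarkovKernel.map _ (measurable_pi_apply _)

theorem lintegral_lastState (k : ℕ) (x : Fin (k + 1) → X) {g : S → ℝ≥0∞} (hg : Measurable g) :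
    ∫⁻ s, g s ∂M.lastState k x = ∫⁻ s, g (s (Fin.last k)) ∂M.states k x := by
  rw [lastState, Kernel.map_apply _ (measurable_pi_apply _),
    lintegral_map hg (measurable_pi_apply _)]

theorem lastState_zero (x : Fin 1 → X) : M.lastState 0 x = M.first (x 0) := by
  rw [lastState, states, Kernel.map_apply _ (measurable_pi_apply _),
    Kernel.map_apply _ (by fun_prop),
    Measure.map_map (by fun_prop) (by fun_prop)]
  exact Measure.map_id

theorem states_succ_apply (k : ℕ) (x : Fin (k + 2) → X) {T : Set (Fin (k + 2) → S)}
    (hT : MeasurableSet T) :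
    M.states (k + 1) x T = ∫⁻ s, M.next k (s (Fin.last k), x (Fin.last (k + 1)))
      {a | (Fin.snoc s a : Fin (k + 2) → S) ∈ T} ∂M.states k (Fin.init x) := by
  have := M.isMarkovKernel_states k
  have := M.isMarkov_next
  rw [states, Kernel.map_apply' _ (measurable_snoc _) _ hT,
    Kernel.compProd_apply (measurable_snoc _ hT)]
  rfl

theorem lastState_succ_apply (k : ℕ) (x : Fin (k + 2) → X) {T : Set S} (hT : MeasurableSet T) :
    M.lastState (k + 1) x T
      = ∫⁻ s, M.next k (s, x (Fin.last (k + 1))) T ∂M.lastState k (Fin.init x) := by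
  rw [lintegral_lastState (g := fun s => M.next k (s, x (Fin.last (k + 1))) T) _ _ _
      (((M.next k).measurable_coe hT).comp measurable_prodMk_right),
    lastState, Kernel.map_apply' _ (measurable_pi_apply _) _ hT,
    states_succ_apply _ _ _ (measurable_pi_apply _ hT)]
  simp

/-- The state at time `k` does not depend on the later data points. -/
theorem states_coord_apply {k n : ℕ} (hk : k ≤ n) (x : Fin (n + 1) → X) {T : Set S}
    (hT : MeasurableSet T) :
    M.states n x {s | s ⟨k, Nat.lt_succ_of_le hk⟩ ∈ T}
      = M.lastState k (fun j => x (Fin.castLE (Nat.succ_le_succ hk) j)) T := by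
  induction n, hk using Nat.le_induction with
  | base =>
    rw [lastState, Kernel.map_apply' _ (measurable_pi_apply _) _ hT]
    rfl
  | succ n hk ih =>
    have := M.isMarkov_next
    rw [states_succ_apply (T := {s | s ⟨k, _⟩ ∈ T}) _ _ _ (measurable_pi_apply _ hT)]
    have hsnoc : ∀ (s : Fin (n + 1) → S) (a : S), (Fin.snoc s a : Fin (n + 2) → S)
        ⟨k, Nat.lt_succ_of_le (Nat.le_succ_of_le hk)⟩ = s ⟨k, Nat.lt_succ_of_le hk⟩ := fun s a =>
      Fin.snoc_castSucc (α := fun _ => S) a s ⟨k, Nat.lt_succ_of_le hk⟩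
    have hT' : MeasurableSet {s : Fin (n + 1) → S | s ⟨k, Nat.lt_succ_of_le hk⟩ ∈ T} :=
      measurable_pi_apply _ hT
    refine Eq.trans ?_ (ih (Fin.init x))
    rw [← lintegral_indicator_one hT']
    refine lintegral_congr fun s => ?_
    by_cases hs : s ⟨k, Nat.lt_succ_of_le hk⟩ ∈ T <;>
    simp [hsnoc, hs]

theorem output_eq_comp (n : ℕ) : M.output n = M.out ∘ₖ M.lastState n := by
  have := M.isMarkovKernel_states n
  have := M.isMarkov_out
  ext x A hA
  rw [output, run, Kernel.map_apply' _ measurable_snd _ hA,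
    Kernel.compProd_apply (measurable_snd hA), Kernel.comp_apply' _ _ _ hA,
    lintegral_lastState _ _ _ (M.out.measurable_coe hA)]
  rfl

theorem view_prod_univ (n : ℕ) (t : Fin (n + 1)) (x : Fin (n + 1) → X) {T : Set S}
    (hT : MeasurableSet T) :
    M.view n t x (T ×ˢ Set.univ) = M.states n x {s | s t ∈ T} := by
  have := M.isMarkovKernel_states n
  have := M.isMarkov_out
  have hT' : MeasurableSet {s : Fin (n + 1) → S | s t ∈ T} := measurable_pi_apply _ hT
  conv_rhs => rw [← Kernel.fst_compProd (M.states n) (M.out.comap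
    (fun p : (Fin (n + 1) → X) × (Fin (n + 1) → S) => p.2 (Fin.last n))
      ((measurable_pi_apply (Fin.last n)).comp measurable_snd))]
  rw [Kernel.fst_apply' _ _ hT', view, Kernel.map_apply' _ (by fun_prop) _ (hT.prod .univ), run]
  congr 1
  ext r
  simp

/-- Pan-privacy at time `k` protects the internal state after the first `k + 1` data points. -/
theorem lastState_apply_le {n : ℕ} {ε δ : ℝ} (hM : IsPanPrivate M n ε δ) {k : ℕ} (hk : k ≤ n)
    {z z' : Fin (k + 1) → X} (hz : Neighbors z z') {T : Set S} (hT : MeasurableSet T) :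
    M.lastState k z T
      ≤ ENNReal.ofReal (Real.exp ε) * M.lastState k z' T + ENNReal.ofReal δ := by
  -- Both streams are continued by the same data point.
  let pad : (Fin (k + 1) → X) → Fin (n + 1) → X := fun y j =>
    if h : j.1 < k + 1 then y ⟨j, h⟩ else z 0
  have hpad : ∀ y, (fun j => pad y (Fin.castLE (Nat.succ_le_succ hk) j)) = y := fun y => by
    ext j
    exact dif_pos j.2
  have hnb : Neighbors (pad z) (pad z') := by
    obtain ⟨i, hi⟩ := hz
    refine ⟨Fin.castLE (Nat.succ_le_succ hk) i, fun j hj => ?_⟩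
    by_cases h : j.1 < k + 1
    · simp only [pad, dif_pos h]
      exact hi _ fun hji => hj (by rw [← hji]; rfl)
    · simp only [pad, dif_neg h]
  have h := hM _ _ hnb ⟨k, Nat.lt_succ_of_le hk⟩ (T ×ˢ Set.univ) (hT.prod .univ)
  rwa [view_prod_univ _ _ _ _ hT, view_prod_univ _ _ _ _ hT, states_coord_apply M hk _ hT,
    states_coord_apply M hk _ hT, hpad, hpad] at h

/-- The law of the internal state after `k + 1` independent data points, the `j`-th of them, counted
from `0`, with law `p j`. -/
noncomputable def stateLaw (p : ℕ → Measure X) : ℕ → Measure S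
  | 0 => M.first ∘ₘ p 0
  | k + 1 => M.next k ∘ₘ (stateLaw p k).prod (p (k + 1))

instance isProbabilityMeasure_stateLaw (p : ℕ → Measure X) [∀ j, IsProbabilityMeasure (p j)]
    (k : ℕ) : IsProbabilityMeasure (M.stateLaw p k) := by
  have := M.isMarkov_first
  have := M.isMarkov_next
  induction k with
  | zero => unfold stateLaw; infer_instance
  | succ k ih => unfold stateLaw; infer_instance

theorem stateLaw_congr {p p' : ℕ → Measure X} {k : ℕ} (h : ∀ j ≤ k, p j = p' j) :
    M.stateLaw p k = M.stateLaw p' k := by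
  induction k with
  | zero => rw [stateLaw, stateLaw, h 0 le_rfl]
  | succ k ih =>
    rw [stateLaw, stateLaw, h _ le_rfl, ih fun j hj => h j (Nat.le_succ_of_le hj)]

theorem measurePreserving_init_last (p : ℕ → Measure X) [∀ j, IsProbabilityMeasure (p j)] (k : ℕ) :
    MeasurePreserving (fun x : Fin (k + 1) → X => ((Fin.init x : Fin k → X), x (Fin.last k)))
      (Measure.pi fun j : Fin (k + 1) => p j)
      ((Measure.pi fun j : Fin k => p j).prod (p k)) := by
  have h := (Measure.measurePreserving_swap.comp
    (measurePreserving_piFinSuccAbove (fun j : Fin (k + 1) => p j) (Fin.last k)))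
  simp only [Fin.succAbove_last, Fin.val_castSucc, Fin.val_last] at h
  convert h using 1
  ext x
  · simp [Fin.init, MeasurableEquiv.piFinSuccAbove, Fin.insertNthEquiv]
  · rfl

/-- On a product measure the law of the last state obeys the one-step recursion of `stateLaw`. -/
theorem lastState_comp_pi (p : ℕ → Measure X) [∀ j, IsProbabilityMeasure (p j)] (k : ℕ) :
    M.lastState k ∘ₘ Measure.pi (fun j : Fin (k + 1) => p j) = M.stateLaw p k := by
  have := M.isMarkov_next
  induction k with
  | zero =>
    ext T hT
    have hT' := M.first.measurable_coe hT
    rw [stateLaw, Measure.bind_apply hT (Kernel.aemeasurable _),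
      Measure.bind_apply hT (Kernel.aemeasurable _)]
    simp only [lastState_zero]
    exact (measurePreserving_eval (fun j : Fin 1 => p j) 0).lintegral_comp hT'
  | succ k ih =>
    ext T hT
    have hT' := (M.next k).measurable_coe hT
    have hm : Measurable fun q : (Fin (k + 1) → X) × X =>
        ∫⁻ s, M.next k (s, q.2) T ∂M.lastState k q.1 :=
      Measurable.lintegral_kernel_prod_right' (κ := (M.lastState k).comap Prod.fst measurable_fst)
        (f := fun r : ((Fin (k + 1) → X) × X) × S => M.next k (r.2, r.1.2) T)
        (hT'.comp (measurable_snd.prodMk (measurable_snd.comp measurable_fst)))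
    rw [stateLaw, Measure.bind_apply hT (Kernel.aemeasurable _),
      Measure.bind_apply hT (Kernel.aemeasurable _), lintegral_prod _ hT'.aemeasurable, ← ih,
      Measure.lintegral_bind (Kernel.aemeasurable _)
        (Measurable.lintegral_prod_right' hT').aemeasurable]
    simp only [M.lastState_succ_apply k _ hT]
    refine ((measurePreserving_init_last p (k + 1)).lintegral_comp hm).trans ?_
    rw [lintegral_prod _ hm.aemeasurable]
    refine lintegral_congr fun y => ?_
    exact lintegral_lintegral_swap (μ := p (k + 1)) (ν := M.lastState k y)
      (f := fun a s => M.next k (s, a) T)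
      (hT'.comp measurable_swap).aemeasurable

theorem outputLaw_pi (p : ℕ → Measure X) [∀ j, IsProbabilityMeasure (p j)] (n : ℕ) :
    M.outputLaw n (Measure.pi fun j : Fin (n + 1) => p j) = M.out ∘ₘ M.stateLaw p n := by
  rw [outputLaw, output_eq_comp, ← lastState_comp_pi, Measure.comp_assoc]

/-- The randomized map from the `k`-th data point (counted from `0`) to the law of the internal
state right after it, when the earlier data points are independent with laws `p j`. -/
noncomputable def randomizer (p : ℕ → Measure X) : ℕ → Kernel X S
  | 0 => M.first
  | k + 1 => M.next k ∘ₖ (Kernel.const X (M.stateLaw p k) ×ₖ Kernel.id)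

instance isMarkovKernel_randomizer (p : ℕ → Measure X) [∀ j, IsProbabilityMeasure (p j)] (k : ℕ) :
    IsMarkovKernel (M.randomizer p k) := by
  have := M.isMarkov_first
  have := M.isMarkov_next
  cases k <;> unfold randomizer <;> infer_instance

theorem randomizer_succ_apply (p : ℕ → Measure X) [∀ j, IsProbabilityMeasure (p j)] (k : ℕ)
    (x : X) {T : Set S} (hT : MeasurableSet T) :
    M.randomizer p (k + 1) x T = ∫⁻ s, M.next k (s, x) T ∂M.stateLaw p k := by
  rw [randomizer, Kernel.comp_apply' _ _ _ hT, Kernel.prod_apply, Kernel.const_apply,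
    Kernel.id_apply, lintegral_prod _ ((M.next k).measurable_coe hT).aemeasurable]
  refine lintegral_congr fun s => ?_
  exact lintegral_dirac' _ (((M.next k).measurable_coe hT).comp measurable_prodMk_left)

theorem randomizer_comp (p : ℕ → Measure X) [∀ j, IsProbabilityMeasure (p j)] (k : ℕ) :
    M.randomizer p k ∘ₘ p k = M.stateLaw p k := by
  cases k with
  | zero => rfl
  | succ k =>
    ext T hT
    have hT' := (M.next k).measurable_coe hT
    rw [stateLaw, Measure.bind_apply hT (Kernel.aemeasurable _),
      Measure.bind_apply hT (Kernel.aemeasurable _), lintegral_prod_symm _ hT'.aemeasurable]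
    simp only [M.randomizer_succ_apply p k _ hT]

/-- In terms of whole streams, `randomizer p (k + 1)` appends its input to a random prefix. This
identity transports the pan-privacy guarantee to it. -/
theorem randomizer_succ_apply_eq_lintegral (p : ℕ → Measure X) [∀ j, IsProbabilityMeasure (p j)]
    (k : ℕ) (x : X) {T : Set S} (hT : MeasurableSet T) :
    M.randomizer p (k + 1) x T = ∫⁻ y : Fin (k + 1) → X,
      M.lastState (k + 1) (Fin.snoc y x : Fin (k + 2) → X) T
        ∂Measure.pi fun j : Fin (k + 1) => p j := by
  rw [M.randomizer_succ_apply p k x hT, ← lastState_comp_pi,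
    Measure.lintegral_bind (f := fun s => M.next k (s, x) T) (Kernel.aemeasurable _)
      (((M.next k).measurable_coe hT).comp measurable_prodMk_right).aemeasurable]
  simp only [M.lastState_succ_apply k _ hT, Fin.snoc_last, Fin.init_snoc]

/-- To an observer of the next internal state only, a pan-private algorithm treats each data point
as a local randomizer does. -/
theorem isLocalRandomizer_randomizer {n : ℕ} {ε δ : ℝ} (hδ : 0 ≤ δ) (hM : IsPanPrivate M n ε δ)
    (p : ℕ → Measure X) [∀ j, IsProbabilityMeasure (p j)] {k : ℕ} (hk : k ≤ n) :
    IsLocalRandomizer (M.randomizer p k) ε δ := by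
  intro x x' T hT
  suffices h : M.randomizer p k x T
      ≤ ENNReal.ofReal (Real.exp ε) * M.randomizer p k x' T + ENNReal.ofReal δ by
    have h' := ENNReal.toReal_mono (ENNReal.add_ne_top.mpr ⟨ENNReal.mul_ne_top
      ENNReal.ofReal_ne_top (measure_ne_top _ _), ENNReal.ofReal_ne_top⟩) h
    rwa [ENNReal.toReal_add (ENNReal.mul_ne_top ENNReal.ofReal_ne_top (measure_ne_top _ _))
      ENNReal.ofReal_ne_top, ENNReal.toReal_mul, ENNReal.toReal_ofReal (Real.exp_pos ε).le,
      ENNReal.toReal_ofReal hδ] at h'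
  cases k with
  | zero =>
    have h := lastState_apply_le M hM hk (z := fun _ => x) (z' := fun _ => x')
      ⟨0, fun j hj => absurd (Subsingleton.elim (α := Fin 1) j 0) hj⟩ hT
    rwa [lastState_zero, lastState_zero] at h
  | succ k =>
    have hm : Measurable fun y : Fin (k + 1) → X =>
        M.lastState (k + 1) (Fin.snoc y x' : Fin (k + 2) → X) T :=
      ((M.lastState (k + 1)).measurable_coe hT).comp
        ((measurable_snoc (k + 1)).comp measurable_prodMk_right)
    rw [M.randomizer_succ_apply_eq_lintegral p k x hT,
      M.randomizer_succ_apply_eq_lintegral p k x' hT,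
      ← lintegral_const_mul _ hm]
    calc _ ≤ ∫⁻ y : Fin (k + 1) → X, (ENNReal.ofReal (Real.exp ε)
            * M.lastState (k + 1) (Fin.snoc y x' : Fin (k + 2) → X) T + ENNReal.ofReal δ)
              ∂Measure.pi fun j : Fin (k + 1) => p j := by
          refine lintegral_mono fun y => lastState_apply_le M hM hk ⟨Fin.last _, fun j hj => ?_⟩ hT
          obtain ⟨i, rfl⟩ := Fin.exists_castSucc_eq.mpr hj
          simp
      _ = _ := by
          rw [lintegral_add_right _ measurable_const]
          simp

/-- Two streams of independent data points with the same laws after time `k` are no easier to tell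
apart at a later time than at time `k`. -/
theorem tvDist_stateLaw_le {p p' : ℕ → Measure X} [∀ j, IsProbabilityMeasure (p j)]
    [∀ j, IsProbabilityMeasure (p' j)] {k n : ℕ} (hk : k ≤ n) (h : ∀ j, k < j → p j = p' j) :
    tvDist (M.stateLaw p n) (M.stateLaw p' n) ≤ tvDist (M.stateLaw p k) (M.stateLaw p' k) := by
  have := M.isMarkov_next
  induction n, hk using Nat.le_induction with
  | base => exact le_rfl
  | succ n hk ih =>
    refine le_trans ?_ ih
    rw [stateLaw, stateLaw, h (n + 1) (Nat.lt_succ_of_le hk)]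
    exact (tvDist_comp_le _ _ _).trans (tvDist_prod_le _ _ _)

end OnlineAlgorithm

/-! ### The hybrid argument -/

section Hybrid

variable {X S O V : Type*} [MeasurableSpace X] [MeasurableSpace S] [MeasurableSpace O]
  [Fintype V] [Nonempty V]

theorem two_le_card_of_tvDist_pos (P : V → Measure X) (M : OnlineAlgorithm X S O) {n : ℕ}
    (h : 0 < tvDist (M.outputLaw n (mixture fun v => Measure.pi fun _ : Fin (n + 1) => P v))
        (M.outputLaw n (Measure.pi fun _ : Fin (n + 1) => mixture P))) :
    2 ≤ Fintype.card V := by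
  by_contra! hcard
  have : Subsingleton V := Fintype.card_le_one_iff_subsingleton.mp (by omega)
  obtain ⟨v⟩ := ‹Nonempty V›
  rw [mixture_of_subsingleton _ v, mixture_of_subsingleton _ v] at h
  exact absurd (tvDist_self_nonpos _) (not_le.mpr h)

variable (P : V → Measure X) [∀ v, IsProbabilityMeasure (P v)]

/-- The laws of the data points of the `i`-th hybrid stream: the first `i` data points come from the
uniform mixture, and all later ones from `P v`. -/
noncomputable def hybrid (v : V) (i : ℕ) : ℕ → Measure X :=
  fun j => if j < i then mixture P else P v

instance isProbabilityMeasure_hybrid (v : V) (i j : ℕ) :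
    IsProbabilityMeasure (hybrid P v i j) := by
  unfold hybrid
  split_ifs <;> infer_instance

variable (M : OnlineAlgorithm X S O)

/-- Consecutive hybrid streams differ in one data point only, and up to it the two streams have a
prefix whose law does not depend on `v`. -/
theorem tvDist_hybrid_le (v : V) {i n : ℕ} (hi : i ≤ n) :
    tvDist (M.out ∘ₘ M.stateLaw (hybrid P v i) n) (M.out ∘ₘ M.stateLaw (hybrid P v (i + 1)) n)
      ≤ tvDist (M.randomizer (fun _ => mixture P) i ∘ₘ P v)
          (M.randomizer (fun _ => mixture P) i ∘ₘ mixture P) := by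
  have := M.isMarkov_out
  refine (tvDist_comp_le _ _ _).trans ((M.tvDist_stateLaw_le hi fun j hj => ?_).trans ?_)
  · simp [hybrid, not_lt.mpr hj.le, not_lt.mpr (Nat.succ_le_of_lt hj)]
  · rw [← M.randomizer_comp, ← M.randomizer_comp]
    have h : ∀ p : ℕ → Measure X, (∀ j < i, p j = mixture P) →
        M.randomizer p i = M.randomizer (fun _ => mixture P) i := by
      intro p hp
      cases i with
      | zero => rfl
      | succ i =>
        rw [OnlineAlgorithm.randomizer, OnlineAlgorithm.randomizer,
          M.stateLaw_congr fun j hj => hp j (Nat.lt_succ_of_le hj)]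
    rw [h (hybrid P v i) fun j hj => by simp [hybrid, hj],
      h (hybrid P v (i + 1)) fun j hj => by simp [hybrid, Nat.lt_succ_of_lt hj]]
    simp [hybrid]

/-- The hybrid argument: the distance between the two output laws is at most the sum of the
distances between consecutive hybrids, averaged over `v`. -/
theorem tvDist_outputLaw_le {n : ℕ} {ε δ : ℝ} (hε : 0 ≤ ε) (hδ : 0 ≤ δ)
    (hM : IsPanPrivate M n ε δ) :
    tvDist (M.outputLaw n (mixture fun v => Measure.pi fun _ : Fin (n + 1) => P v))
        (M.outputLaw n (Measure.pi fun _ : Fin (n + 1) => mixture P))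
      ≤ ((n + 1 : ℕ) : ℝ) * ((Real.exp ε - 1) * infTwoNorm P + 4 * δ) := by
  have := M.isMarkov_out
  refine tvDist_le fun A hA => ?_
  set G : V → ℕ → ℝ := fun v i => (M.out ∘ₘ M.stateLaw (hybrid P v i) n).real A with hG
  have hstart : (M.outputLaw n (mixture fun v => Measure.pi fun _ : Fin (n + 1) => P v)).real A
      = (Fintype.card V : ℝ)⁻¹ * ∑ v, G v 0 := by
    have h : ∀ v, M.output n ∘ₘ (Measure.pi fun _ : Fin (n + 1) => P v)
        = M.out ∘ₘ M.stateLaw (hybrid P v 0) n := fun v => by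
      rw [M.stateLaw_congr (p' := fun _ => P v) (by simp [hybrid]), ← M.outputLaw_pi]
      rfl
    rw [OnlineAlgorithm.outputLaw, mixture_bind]
    simp only [h]
    exact mixture_real_apply _ A
  have hend : ∀ v, (M.outputLaw n (Measure.pi fun _ : Fin (n + 1) => mixture P)).real A
      = G v (n + 1) := fun v => by
    rw [M.outputLaw_pi (fun _ => mixture P)]
    simp only [hG]
    rw [M.stateLaw_congr (p := hybrid P v (n + 1)) (p' := fun _ => mixture P)
      fun j hj => by simp [hybrid, Nat.lt_succ_of_le hj]]
  have hend' : (M.outputLaw n (Measure.pi fun _ : Fin (n + 1) => mixture P)).real A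
      = (Fintype.card V : ℝ)⁻¹ * ∑ v, G v (n + 1) := by
    rw [← Finset.sum_congr rfl fun v _ => hend v]
    simp
  set Q := fun i => M.randomizer (fun _ => mixture P) i
  have hstep : ∀ v, |G v 0 - G v (n + 1)|
      ≤ ∑ i ∈ Finset.range (n + 1), tvDist (Q i ∘ₘ P v) (Q i ∘ₘ mixture P) := fun v => by
    rw [← Finset.sum_range_sub' (G v)]
    refine (Finset.abs_sum_le_sum_abs _ _).trans (Finset.sum_le_sum fun i hi => ?_)
    exact (abs_real_sub_le_tvDist _ _ hA).trans
      (tvDist_hybrid_le P M v (Nat.lt_succ_iff.mp (Finset.mem_range.mp hi)))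
  rw [hstart, hend', ← mul_sub, ← Finset.sum_sub_distrib, abs_mul, abs_of_nonneg (by positivity)]
  calc _ ≤ (Fintype.card V : ℝ)⁻¹ *
        ∑ v, ∑ i ∈ Finset.range (n + 1), tvDist (Q i ∘ₘ P v) (Q i ∘ₘ mixture P) := by
        gcongr
        exact (Finset.abs_sum_le_sum_abs _ _).trans (Finset.sum_le_sum fun v _ => hstep v)
    _ = ∑ i ∈ Finset.range (n + 1), (Fintype.card V : ℝ)⁻¹ *
        ∑ v, tvDist (Q i ∘ₘ P v) (Q i ∘ₘ mixture P) := by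
        rw [Finset.sum_comm, Finset.mul_sum]
    _ ≤ ∑ i ∈ Finset.range (n + 1), ((Real.exp ε - 1) * infTwoNorm P + 4 * δ) :=
        Finset.sum_le_sum fun i hi => average_tvDist_le P hε
          (M.isLocalRandomizer_randomizer hδ hM _ (Nat.lt_succ_iff.mp (Finset.mem_range.mp hi)))
    _ = _ := by rw [Finset.sum_const, Finset.card_range, nsmul_eq_mul]

end Hybrid

/-! ### Elementary inequalities -/

theorem exp_sub_one_le {ε ε₀ : ℝ} (hε : 0 ≤ ε) (h : ε ≤ ε₀) :
    Real.exp ε - 1 ≤ Real.exp ε₀ * ε := by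
  have h1 := Real.add_one_le_exp (-ε)
  have h2 : Real.exp ε * Real.exp (-ε) = 1 := by rw [← Real.exp_add]; simp
  have h3 := mul_le_mul_of_nonneg_right (Real.exp_le_exp.mpr h) hε
  nlinarith [Real.exp_pos ε]

/-- With at least two distributions, the additive error `δ` is dominated by the second term of the
lower bound. -/
theorem le_two_mul_sqrt_mul_log {δ m : ℝ} (hδ : 0 ≤ δ) (hδ1 : δ ≤ 1) (hm : 2 ≤ m) :
    δ ≤ 2 * Real.sqrt (δ * Real.log (m / δ)) := by
  rcases hδ.eq_or_lt with rfl | hδ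
  · -- Both sides are `0` here, whatever the value of `Real.log (m / 0)`.
    simp
  have h1 : (1 : ℝ) / 2 ≤ Real.log (m / δ) := by
    have h2 : Real.log 2 ≤ Real.log (m / δ) :=
      Real.log_le_log two_pos ((le_div_iff₀ hδ).mpr (by nlinarith))
    linarith [Real.log_two_gt_d9]
  have h3 : δ / 2 ≤ Real.sqrt (δ * Real.log (m / δ)) :=
    Real.le_sqrt_of_sq_le (by nlinarith)
  linarith

end PanPrivacy

/-! ### The lower bound -/

theorem theorem3p1 :
    ∃ κ : ℝ, 0 < κ ∧
      ∀ ε₀ : ℝ, 0 < ε₀ → ∀ c : ℝ, 0 < c → ∃ C : ℝ, 0 < C ∧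
        ∀ (X S O V : Type*) [MeasurableSpace X] [MeasurableSpace S] [MeasurableSpace O]
          [Fintype V] [Nonempty V]
          (P : V → Measure X) (_hP : ∀ v, IsProbabilityMeasure (P v))
          (M : PanPrivacy.OnlineAlgorithm X S O) (n : ℕ)
          (ε δ : ℝ) (_hε : 0 ≤ ε) (_hε₀ : ε ≤ ε₀) (_hδ : 0 ≤ δ) (_hδ1 : δ ≤ 1)
          (_hM : PanPrivacy.IsPanPrivate M n ε δ)
          (_hTV : c ≤ PanPrivacy.tvDist
            (M.outputLaw n (PanPrivacy.mixture fun v => Measure.pi fun _ : Fin (n + 1) => P v))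
            (M.outputLaw n (Measure.pi fun _ : Fin (n + 1) => PanPrivacy.mixture P))),
          (δ * Real.log (Fintype.card V / δ) ≤ κ * (ε ^ 2 * PanPrivacy.infTwoNorm P ^ 2) →
            0 < ε * PanPrivacy.infTwoNorm P ∧
              1 / (C * (ε * PanPrivacy.infTwoNorm P)) ≤ ((n + 1 : ℕ) : ℝ)) ∧
          (0 < ε * PanPrivacy.infTwoNorm P + Real.sqrt (δ * Real.log (Fintype.card V / δ)) ∧
            1 / (C * (ε * PanPrivacy.infTwoNorm P +
              Real.sqrt (δ * Real.log (Fintype.card V / δ)))) ≤ ((n + 1 : ℕ) : ℝ)) := by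
  -- Any constant `κ` would do: when `κ = 1` the term with `δ` is at most the other term.
  refine ⟨1, one_pos, fun ε₀ _ c hc => ?_⟩
  have hexp := Real.exp_pos ε₀
  refine ⟨2 * (Real.exp ε₀ + 8) / c, by positivity, ?_⟩
  intro X S O V _ _ _ _ _ P _ M n ε δ hε hε₀ hδ hδ1 hM hTV
  have hcard : (2 : ℝ) ≤ Fintype.card V := by
    exact_mod_cast PanPrivacy.two_le_card_of_tvDist_pos P M (hc.trans_le hTV)
  have hN := PanPrivacy.infTwoNorm_nonneg P
  have hmain := hTV.trans (PanPrivacy.tvDist_outputLaw_le P M hε hδ hM)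
  have hs := PanPrivacy.le_two_mul_sqrt_mul_log hδ hδ1 hcard
  have he := mul_le_mul_of_nonneg_right (PanPrivacy.exp_sub_one_le hε hε₀) hN
  set N := PanPrivacy.infTwoNorm P
  set s := Real.sqrt (δ * Real.log (Fintype.card V / δ))
  have hs0 : 0 ≤ s := Real.sqrt_nonneg _
  have hεN : 0 ≤ ε * N := mul_nonneg hε hN
  have hn : (0 : ℝ) < ((n + 1 : ℕ) : ℝ) := by positivity
  have hbound : c ≤ ((n + 1 : ℕ) : ℝ) * ((Real.exp ε₀ + 8) * (ε * N + s)) := by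
    refine hmain.trans (mul_le_mul_of_nonneg_left ?_ hn.le)
    nlinarith [mul_nonneg hexp.le hs0]
  have conclude : ∀ a : ℝ, 0 ≤ a → ε * N + s ≤ 2 * a →
      0 < a ∧ 1 / (2 * (Real.exp ε₀ + 8) / c * a) ≤ ((n + 1 : ℕ) : ℝ) := by
    intro a ha h
    have hb : c ≤ ((n + 1 : ℕ) : ℝ) * ((Real.exp ε₀ + 8) * (2 * a)) := hbound.trans (by gcongr)
    have ha' : 0 < a := by
      refine ha.lt_of_ne fun h0 => ?_
      rw [← h0] at hb
      simp only [mul_zero] at hb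
      linarith
    refine ⟨ha', ?_⟩
    rw [div_le_iff₀ (by positivity), div_mul_eq_mul_div, mul_div_assoc', le_div_iff₀ hc]
    linarith
  refine ⟨fun hsmall => conclude _ hεN ?_, conclude _ (by positivity) (by linarith)⟩
  have : s ≤ ε * N := Real.sqrt_le_iff.mpr ⟨hεN, by linarith [mul_pow ε N 2]⟩
  linarith
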